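/- Consider the non-stationary dueling bandits problem with $K$ arms, time horizon $T$ and $M$ segments. An instance consists of changepoints $1=\nu_0<\nu_1<\dots<\nu_M=T+1$ and, for each segment $S_m=\{\nu_{m-1},\dots,\nu_m-1\}$, a preference matrix $P^{(m)}\in[0,1]^{K\times K}$ with $P^{(m)}_{i,j}+P^{(m)}_{j,i}=1$ for all $i,j$ that has a Condorcet winner $m^*$, i.e. $P^{(m)}_{m^*,i}>\frac12$ for all $i\ne m^*$. In each time step $t\in S_m$ the (possibly randomized) algorithm chooses, depending on the history of its previous pairs and observed outcomes, a pair of arms $(I_t,J_t)$ (possibly $I_t=J_t$), and then observes the outcome of a duel, which is distributed as $\mathrm{Ber}(P^{(m)}_{I_t,J_t})$ and, given the pair, independent of the past. With $\Delta_i^{(m)}=P^{(m)}_{m^*,i}-\frac12$, the weak regret in step $t\in S_m$ is $r_t^{\mathrm W}=\min\{\Delta^{(m)}_{I_t},\Delta^{(m)}_{J_t}\}$ and the binary weak regret is $r_t^{\bar{\mathrm W}}=\lceil r_t^{\mathrm W}\rceil$; put $R^{\mathrm W}=\sum_{t=1}^T r_t^{\mathrm W}$ and $R^{\bar{\mathrm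 W}}=\sum_{t=1}^T r_t^{\bar{\mathrm W}}$. The problem is called stationary if $M=1$. **Theorem.** (i) There is an absolute constant $c>0$ such that for all $K\ge 3$, $1\le M\le T$ with $M(K-1)\le 9T$ and for every algorithm there is an instance with $K$ arms, $M$ segments and horizon $T$ on which $$\mathbb E[R^{\mathrm W}]\ge c\sqrt{KMT}\quad\text{and}\quad \mathbb E[R^{\bar{\mathrm W}}]\ge c\sqrt{KMT}.$$ (ii) There is an absolute constant $c>0$ such that for all $K\ge 3$, $T\ge 1$ with $K-1\le 9T$ and for every algorithm there is a stationary instance with $K$ arms and horizon $T$ on which $$\mathbb E[R^{\mathrm W}]\ge c\sqrt{KT}\quad\text{and}\quad \mathbb E[R^{\bar{\mathrm W}}]\ge c\sqrt{KT}.$$ -/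

import Mathlib

noncomputable section

namespace DuelingBandits

open scoped BigOperators

/-- A preference matrix on `K` arms: `prob i j` is the probability that arm `i` wins a duel
against arm `j`; there is an arm (the Condorcet winner, unique by `winner_beats`) that beats
every other arm with probability greater than one half. -/
structure PreferenceMatrix (K : ℕ) where
  prob : Fin K → Fin K → ℝ
  prob_mem : ∀ i j, prob i j ∈ Set.Icc (0 : ℝ) 1
  prob_add_prob : ∀ i j, prob i j + prob j i = 1
  winner : Fin K
  winner_beats : ∀ i, i ≠ winner → 1 / 2 < prob winner i

namespace PreferenceMatrix

variable {K : ℕ}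

/-- The Bernoulli law with parameter `prob i j` of the outcome of the duel of `i` and `j`;
`true` means that `i` wins. -/
def duel (P : PreferenceMatrix K) (i j : Fin K) : PMF Bool :=
  PMF.ofFintype (fun b => ENNReal.ofReal (bif b then P.prob i j else 1 - P.prob i j)) (by
    have h := P.prob_mem i j
    rw [Fintype.sum_bool, cond_true, cond_false,
      ← ENNReal.ofReal_add h.1 (sub_nonneg.2 h.2)]
    simp)

/-- The suboptimality gap of arm `i`. -/
def gap (P : PreferenceMatrix K) (i : Fin K) : ℝ := P.prob P.winner i - 1 / 2

/-- The instantaneous weak regret of playing the pair `(a.1, a.2)`. -/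
def weakRegret (P : PreferenceMatrix K) (a : Fin K × Fin K) : ℝ := min (P.gap a.1) (P.gap a.2)

/-- The instantaneous binary weak regret of playing the pair `(a.1, a.2)`. -/
def binaryWeakRegret (P : PreferenceMatrix K) (a : Fin K × Fin K) : ℝ :=
  (⌈P.weakRegret a⌉ : ℤ)

end PreferenceMatrix

/-- An instance of the non-stationary dueling bandits problem with `K` arms, time horizon `T` and
`M` stationary segments: changepoints `1 = ν 0 < ν 1 < ⋯ < ν M = T + 1` and a preference matrix
for each segment. -/
structure Instance (K M T : ℕ) where
  ν : Fin (M + 1) → ℕ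
  ν_strictMono : StrictMono ν
  ν_zero : ν 0 = 1
  ν_last : ν (Fin.last M) = T + 1
  pref : Fin M → PreferenceMatrix K

/-- An instance of the stationary dueling bandits problem: there is a single segment. -/
abbrev StationaryInstance (K T : ℕ) := Instance K 1 T

namespace Instance

variable {K M T : ℕ}

/-- The `m`-th stationary segment, a set of time steps in `{1, …, T}`. -/
def stationarySegment (I : Instance K M T) (m : Fin M) : Finset ℕ :=
  Finset.Ico (I.ν m.castSucc) (I.ν m.succ)

theorem exists_mem_stationarySegment (I : Instance K M T) (t : Fin T) :
    ∃ m : Fin M, (t : ℕ) + 1 ∈ I.stationarySegment m := by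
  by_contra! hcon
  have key : ∀ m : Fin (M + 1), I.ν m ≤ (t : ℕ) + 1 := by
    intro m
    induction m using Fin.induction with
    | zero => rw [I.ν_zero]; omega
    | succ i ih =>
      have h := hcon i
      simp only [stationarySegment, Finset.mem_Ico, not_and, not_lt] at h
      exact h ih
  have h := key (Fin.last M)
  rw [I.ν_last] at h
  have := t.isLt
  omega

/-- The index of the segment that contains the time step `t + 1` (the elements `t` of `Fin T`
count the time steps from zero). -/
def segmentOf (I : Instance K M T) (t : Fin T) : Fin M :=
  (I.exists_mem_stationarySegment t).choose

theorem mem_stationarySegment_segmentOf (I : Instance K M T) (t : Fin T) :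
    (t : ℕ) + 1 ∈ I.stationarySegment (I.segmentOf t) :=
  (I.exists_mem_stationarySegment t).choose_spec

/-- The preference matrix in force at the time step `t + 1`. -/
def prefAt (I : Instance K M T) (t : Fin T) : PreferenceMatrix K := I.pref (I.segmentOf t)

end Instance

/-- What the learner sees in one time step: the pair that it played and the outcome of the duel. -/
abbrev Round (K : ℕ) := (Fin K × Fin K) × Bool

/-- The histories of the first `t` time steps. -/
abbrev History (K t : ℕ) := Fin t → Round K

/-- A (possibly randomized) algorithm for `K` arms: the conditional law of the next pair of arms
given the history so far. Both arms of a pair may coincide. -/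
structure Algorithm (K : ℕ) where
  choosePair : (t : ℕ) → History K t → PMF (Fin K × Fin K)

variable {K M T : ℕ}

/-- The law of the history of the first `t` time steps when the algorithm `A` runs on the
instance `I`: in each step the algorithm draws a pair from the history, and then the outcome
of the duel is drawn, independently of the past given this pair, from the preference matrix
in force. -/
def historyLaw (A : Algorithm K) (I : Instance K M T) : (t : ℕ) → t ≤ T → PMF (History K t)
  | 0, _ => PMF.pure Fin.elim0
  | t + 1, ht =>
    (historyLaw A I t (Nat.le_of_succ_le ht)).bind fun h =>
      (A.choosePair t h).bind fun a =>
        ((I.prefAt ⟨t, ht⟩).duel a.1 a.2).map fun x =>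
          (Fin.snoc (α := fun _ => Round K) h (a, x) : History K (t + 1))

/-- The expectation of a function of the full history (there are finitely many histories). -/
def expectation (A : Algorithm K) (I : Instance K M T) (f : History K T → ℝ) : ℝ :=
  ∑ h : History K T, (historyLaw A I T le_rfl h).toReal * f h

/-- The expected cumulative weak regret of the algorithm `A` on the instance `I`. -/
def expectedWeakRegret (A : Algorithm K) (I : Instance K M T) : ℝ :=
  expectation A I fun h => ∑ t : Fin T, (I.prefAt t).weakRegret (h t).1

/-- The expected cumulative binary weak regret of the algorithm `A` on the instance `I`. -/
def expectedBinaryWeakRegret (A : Algorithm K) (I : Instance K M T) : ℝ :=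
  expectation A I fun h => ∑ t : Fin T, (I.prefAt t).binaryWeakRegret (h t).1

end DuelingBandits

end

noncomputable section

namespace DuelingBandits

open scoped BigOperators

variable {K M T : ℕ}

/-! In each segment let one hidden arm beat all others with probability 1/2 + ε while every other
duel is fair. A step costs ε unless the hidden arm is in the pair, and only duels involving that arm
reveal anything about it. Choose the hidden arms uniformly and compare each segment with a version
where all its duels are fair. There the plays of all arms add up to at most twice the segment length
n, so a typical arm is played about 2n/K times. Making it the winner costs relative entropy at most
8ε² per expected play (`sum_historyWeight_neg_log_le`), hence changes its play count little when ε²n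
is small compared with K (`sum_historyWeight_playCount_le`). Averaged over the winner, the segment
costs at least εn/6 (`le_sum_segmentRegret`). Averaging over all winner assignments adds up the
segments and yields one bad instance. Balanced segments and ε of order √(KM/T) give √(KMT). The
binary regret dominates the weak regret, and the stationary case is M = 1. -/

/-! ### Laws of histories as explicit products -/

/-- The probability of a history when the algorithm `A` faces the outcome weights `w`: in the time
step `t`, the pair `r.1` has the outcome `r.2` with probability `w t r`. -/
def historyWeight (A : Algorithm K) (w : ℕ → Round K → ℝ) : (n : ℕ) → History K n → ℝ
  | 0, _ => 1
  | n + 1, h =>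
    historyWeight A w n (Fin.init h) *
      ((A.choosePair n (Fin.init h) (h (Fin.last n)).1).toReal * w n (h (Fin.last n)))

theorem sum_toReal_pmf {α : Type*} [Fintype α] (p : PMF α) : ∑ a, (p a).toReal = 1 := by
  rw [← ENNReal.toReal_sum fun a _ => p.apply_ne_top a, ← tsum_fintype (L := .unconditional _),
    p.tsum_coe, ENNReal.toReal_one]

theorem sum_history_succ (n : ℕ) (F : History K (n + 1) → ℝ) :
    ∑ h, F h = ∑ h : History K n, ∑ a : Fin K × Fin K, ∑ x : Bool,
      F (Fin.snoc (α := fun _ => Round K) h (a, x)) := by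
  rw [← (Fin.snocEquiv fun _ : Fin (n + 1) => Round K).sum_comp F, Fintype.sum_prod_type,
    Finset.sum_comm]
  refine Finset.sum_congr rfl fun h _ => ?_
  rw [Fintype.sum_prod_type]
  rfl

section historyWeight

variable (A : Algorithm K) (w : ℕ → Round K → ℝ)

theorem historyWeight_snoc (n : ℕ) (h : History K n) (r : Round K) :
    historyWeight A w (n + 1) (Fin.snoc (α := fun _ => Round K) h r) =
      historyWeight A w n h * ((A.choosePair n h r.1).toReal * w n r) := by
  simp [historyWeight]

variable {w}

theorem historyWeight_nonneg (hw : ∀ t r, 0 ≤ w t r) (n : ℕ) (h : History K n) :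
    0 ≤ historyWeight A w n h := by
  induction n with
  | zero => simp [historyWeight]
  | succ n ih =>
    exact mul_nonneg (ih _) (mul_nonneg ENNReal.toReal_nonneg (hw _ _))

/-- A function of the first `n` rounds has the same expectation after `n + 1` rounds. -/
theorem sum_historyWeight_succ (hw : ∀ t a, ∑ x, w t (a, x) = 1) (n : ℕ) (f : History K n → ℝ) :
    ∑ h : History K (n + 1), historyWeight A w (n + 1) h * f (Fin.init h) =
      ∑ h, historyWeight A w n h * f h := by
  rw [sum_history_succ]
  refine Finset.sum_congr rfl fun h _ => ?_
  simp only [historyWeight_snoc, Fin.init_snoc]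
  simp_rw [← Finset.sum_mul, ← Finset.mul_sum, hw, mul_one, sum_toReal_pmf, mul_one]

theorem sum_historyWeight (hw : ∀ t a, ∑ x, w t (a, x) = 1) (n : ℕ) :
    ∑ h : History K n, historyWeight A w n h = 1 := by
  induction n with
  | zero => simp [historyWeight]
  | succ n ih => simpa [ih] using sum_historyWeight_succ A hw n fun _ => 1

/-- A martingale difference has mean zero: rounds after `t` integrate out, and given the pair the
outcome of round `t` is independent of the past. -/
theorem sum_historyWeight_eq_zero (hw : ∀ t a, ∑ x, w t (a, x) = 1) {n : ℕ} (t : Fin n)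
    (ψ : Round K → ℝ) (hψ : ∀ a, ∑ x, w t (a, x) * ψ (a, x) = 0) :
    ∑ h : History K n, historyWeight A w n h * ψ (h t) = 0 := by
  induction n with
  | zero => exact t.elim0
  | succ n ih =>
    induction t using Fin.lastCases with
    | last =>
      rw [sum_history_succ]
      refine Finset.sum_eq_zero fun h _ => Finset.sum_eq_zero fun a _ => ?_
      simp only [historyWeight_snoc, Fin.snoc_last]
      simp_rw [mul_assoc, ← Finset.mul_sum]
      have := hψ a
      simp only [Fin.val_last] at this
      rw [this, mul_zero, mul_zero]
    | cast t =>
      rw [← ih t hψ]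
      exact sum_historyWeight_succ A hw n fun h => ψ (h t)

/-- The expected value of a function of one round, with the outcome averaged out. -/
theorem sum_historyWeight_mul_eq (hw : ∀ t a, ∑ x, w t (a, x) = 1) {n : ℕ} (t : Fin n)
    (φ : Round K → ℝ) :
    ∑ h : History K n, historyWeight A w n h * φ (h t) =
      ∑ h : History K n, historyWeight A w n h *
        ∑ x, w t ((h t).1, x) * φ ((h t).1, x) := by
  have := sum_historyWeight_eq_zero A hw t
    (fun r => φ r - ∑ x, w t (r.1, x) * φ (r.1, x)) (fun a => by
      simp only [mul_sub, Finset.sum_sub_distrib, ← Finset.sum_mul, hw, one_mul, sub_self])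
  simpa only [mul_sub, Finset.sum_sub_distrib, sub_eq_zero] using this

theorem historyWeight_mul_prod (l : ℕ → Round K → ℝ) (n : ℕ) (h : History K n) :
    historyWeight A (fun t r => w t r * l t r) n h =
      historyWeight A w n h * ∏ t : Fin n, l t (h t) := by
  induction n with
  | zero => simp [historyWeight]
  | succ n ih =>
    simp only [historyWeight, ih, Fin.prod_univ_castSucc, Fin.val_castSucc, Fin.val_last]
    simp only [Fin.init]
    ring

end historyWeight

/-- Working with weights instead of instances admits the fair comparison environment, which has no
Condorcet winner in one segment. -/
theorem toReal_historyLaw (A : Algorithm K) (I : Instance K M T) (w : ℕ → Round K → ℝ)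
    (hw : ∀ (t : Fin T) (r : Round K), w t r = ((I.prefAt t).duel r.1.1 r.1.2 r.2).toReal)
    (n : ℕ) (hn : n ≤ T) (h : History K n) :
    (historyLaw A I n hn h).toReal = historyWeight A w n h := by
  induction n with
  | zero =>
    have : h = Fin.elim0 := Subsingleton.elim _ _
    simp [historyLaw, historyWeight, PMF.pure_apply, this]
  | succ n ih =>
    induction h using Fin.snocCases with
    | snoc h r =>
    obtain ⟨a, x⟩ := r
    rw [historyWeight_snoc, ← ih (Nat.le_of_succ_le hn), hw ⟨n, hn⟩, ← ENNReal.toReal_mul,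
      ← ENNReal.toReal_mul]
    congr 1
    rw [historyLaw, PMF.bind_apply, tsum_eq_single h]
    · congr 1
      rw [PMF.bind_apply, tsum_eq_single a]
      · congr 1
        rw [PMF.map_apply, tsum_eq_single x]
        · simp
        · intro y hy
          rw [if_neg]
          intro e
          exact hy (by simpa using congrArg Prod.snd ((Fin.snoc_inj.1 e).2).symm)
      · intro b hb
        rw [PMF.map_apply]
        simp only [mul_eq_zero]
        right
        refine ENNReal.tsum_eq_zero.2 fun y => if_neg fun e => hb ?_
        exact (congrArg Prod.fst (Fin.snoc_inj.1 e).2).symm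
    · intro g hg
      simp only [mul_eq_zero]
      right
      rw [PMF.bind_apply]
      refine ENNReal.tsum_eq_zero.2 fun b => mul_eq_zero.2 (Or.inr ?_)
      rw [PMF.map_apply]
      refine ENNReal.tsum_eq_zero.2 fun y => if_neg fun e => hg ?_
      exact (Fin.snoc_inj.1 e).1.symm

theorem expectation_eq_sum_historyWeight (A : Algorithm K) (I : Instance K M T)
    (w : ℕ → Round K → ℝ)
    (hw : ∀ (t : Fin T) (r : Round K), w t r = ((I.prefAt t).duel r.1.1 r.1.2 r.2).toReal)
    (f : History K T → ℝ) :
    expectation A I f = ∑ h, historyWeight A w T h * f h := by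
  simp only [expectation, toReal_historyLaw A I w hw]

theorem PreferenceMatrix.weakRegret_le_binaryWeakRegret (P : PreferenceMatrix K)
    (a : Fin K × Fin K) : P.weakRegret a ≤ P.binaryWeakRegret a :=
  Int.le_ceil _

theorem expectedWeakRegret_le_expectedBinaryWeakRegret (A : Algorithm K) (I : Instance K M T) :
    expectedWeakRegret A I ≤ expectedBinaryWeakRegret A I :=
  Finset.sum_le_sum fun _ _ => mul_le_mul_of_nonneg_left
    (Finset.sum_le_sum fun _ _ => PreferenceMatrix.weakRegret_le_binaryWeakRegret _ _)
    ENNReal.toReal_nonneg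

/-! ### The hard preference matrix -/

/-- The preference matrix in which `k` beats every other arm with probability `1 / 2 + ε` and all
other duels are fair. -/
def singleWinner (ε : ℝ) (hε : 0 < ε) (hε' : ε ≤ 1 / 2) (k : Fin K) : PreferenceMatrix K where
  prob i j := 1 / 2 + ε * ((if i = k then 1 else 0) - (if j = k then 1 else 0))
  prob_mem i j := by split_ifs <;> constructor <;> linarith
  prob_add_prob i j := by ring
  winner := k
  winner_beats i hi := by simp [hi, hε]

/-- The probability of the outcome `r.2` of the duel of the pair `r.1` in `singleWinner`. -/
def outcomeWeight (ε : ℝ) (k : Fin K) (r : Round K) : ℝ :=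
  1 / 2 + ε * (((if r.1.1 = k then 1 else 0) - (if r.1.2 = k then 1 else 0)) *
    (if r.2 then 1 else -1))

/-- The indicator that the arm `k` belongs to the pair `a`. -/
def playIndicator (k : Fin K) (a : Fin K × Fin K) : ℝ := if a.1 = k ∨ a.2 = k then 1 else 0

theorem playIndicator_nonneg (k : Fin K) (a : Fin K × Fin K) : 0 ≤ playIndicator k a := by
  unfold playIndicator; split_ifs <;> norm_num

theorem playIndicator_le_one (k : Fin K) (a : Fin K × Fin K) : playIndicator k a ≤ 1 := by
  unfold playIndicator; split_ifs <;> norm_num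

theorem sum_playIndicator_le_two (a : Fin K × Fin K) : ∑ k, playIndicator k a ≤ 2 := by
  calc ∑ k, playIndicator k a
      ≤ ∑ k, ((if a.1 = k then 1 else 0) + (if a.2 = k then 1 else 0) : ℝ) :=
        Finset.sum_le_sum fun k _ => by
          unfold playIndicator
          by_cases h1 : a.1 = k <;> by_cases h2 : a.2 = k <;> simp [h1, h2]
    _ = 2 := by simp [Finset.sum_add_distrib]; norm_num

theorem toReal_duel_singleWinner {ε : ℝ} (hε : 0 < ε) (hε' : ε ≤ 1 / 2) (k : Fin K)
    (r : Round K) :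
    ((singleWinner ε hε hε' k).duel r.1.1 r.1.2 r.2).toReal = outcomeWeight ε k r := by
  obtain ⟨⟨i, j⟩, x⟩ := r
  have h := (singleWinner ε hε hε' k).prob_mem i j
  cases x
  · simp only [PreferenceMatrix.duel, PMF.ofFintype_apply, cond_false]
    rw [ENNReal.toReal_ofReal (by linarith [h.2])]
    simp only [singleWinner, outcomeWeight]
    simp
    ring
  · simp only [PreferenceMatrix.duel, PMF.ofFintype_apply, cond_true]
    rw [ENNReal.toReal_ofReal h.1]
    simp [singleWinner, outcomeWeight]

theorem weakRegret_singleWinner {ε : ℝ} (hε : 0 < ε) (hε' : ε ≤ 1 / 2) (k : Fin K)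
    (a : Fin K × Fin K) :
    (singleWinner ε hε hε' k).weakRegret a = ε * (1 - playIndicator k a) := by
  obtain ⟨i, j⟩ := a
  simp only [PreferenceMatrix.weakRegret, PreferenceMatrix.gap, singleWinner, playIndicator]
  by_cases h1 : i = k <;> by_cases h2 : j = k <;> simp [h1, h2, hε.le]

theorem sum_outcomeWeight (ε : ℝ) (k : Fin K) (a : Fin K × Fin K) :
    ∑ x, outcomeWeight ε k (a, x) = 1 := by
  rw [Fintype.sum_bool]
  simp [outcomeWeight]
  ring

theorem outcomeWeight_pos {ε : ℝ} (hε : 0 < ε) (hε' : ε < 1 / 2) (k : Fin K) (r : Round K) :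
    0 < outcomeWeight ε k r := by
  unfold outcomeWeight
  split_ifs <;> linarith

/-! ### Entropy inequalities -/

theorem neg_log_le_inv_sub_one {x : ℝ} (hx : 0 < x) : -Real.log x ≤ x⁻¹ - 1 := by
  rw [← Real.log_inv]
  exact Real.log_le_sub_one_of_pos (inv_pos.2 hx)

/-- The relative entropy of a fair duel with respect to a duel in `singleWinner`. -/
theorem sum_neg_log_outcomeWeight_le {ε : ℝ} (hε : 0 < ε) (hε' : ε ≤ 1 / 4) (k : Fin K)
    (a : Fin K × Fin K) :
    ∑ x, 1 / 2 * -Real.log (2 * outcomeWeight ε k (a, x)) ≤ 8 * ε ^ 2 * playIndicator k a := by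
  -- The left side is at most 2/(1 - 4ε²) - 2 = 8ε²/(1 - 4ε²), and 4ε² ≤ 1/4.
  have key : -Real.log (1 + 2 * ε) + -Real.log (1 - 2 * ε) ≤ 16 * ε ^ 2 := by
    have h1 := neg_log_le_inv_sub_one (x := 1 + 2 * ε) (by linarith)
    have h2 := neg_log_le_inv_sub_one (x := 1 - 2 * ε) (by linarith)
    have h3 : (1 + 2 * ε)⁻¹ + (1 - 2 * ε)⁻¹ ≤ 2 + 16 * ε ^ 2 := by
      have e : (1 + 2 * ε)⁻¹ + (1 - 2 * ε)⁻¹ = 2 / (1 - 4 * ε ^ 2) := by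
        have a1 : 1 + 2 * ε ≠ 0 := by linarith
        have a2 : 1 - 2 * ε ≠ 0 := by linarith
        have a3 : 1 - 4 * ε ^ 2 = (1 + 2 * ε) * (1 - 2 * ε) := by ring
        rw [a3]
        field_simp
        ring
      have h4 : ε ^ 2 ≤ 1 / 16 := by nlinarith
      rw [e, div_le_iff₀ (by linarith)]
      nlinarith [sq_nonneg ε]
    linarith
  rw [Fintype.sum_bool]
  obtain ⟨i, j⟩ := a
  have e1 : (2 : ℝ) * (1 / 2 + ε) = 1 + 2 * ε := by ring
  have e2 : (2 : ℝ) * (1 / 2 + -ε) = 1 - 2 * ε := by ring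
  have e3 : (2 : ℝ) * (1 / 2) = 1 := by norm_num
  by_cases h1 : i = k <;> by_cases h2 : j = k <;>
    simp only [outcomeWeight, playIndicator, h1, h2, if_true, if_false, or_self, or_true, true_or,
      sub_self, sub_zero, zero_sub, mul_one, mul_zero, mul_neg, neg_neg, add_zero,
      neg_zero, Bool.false_eq_true, e1, e2, e3, Real.log_one]
  · positivity
  · linarith
  · linarith
  · norm_num

/-- A pointwise, linearized substitute for Pinsker's inequality: with `x` a likelihood ratio, its
expectation bounds the L¹ distance by 1/12 plus 12 times the relative entropy. -/
theorem abs_sub_one_le {x : ℝ} (hx : 0 < x) :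
    |x - 1| ≤ (x + 1) / 24 + 12 * (x - 1 - Real.log x) := by
  obtain ⟨s, hs, rfl⟩ : ∃ s : ℝ, 0 < s ∧ s ^ 2 = x := ⟨√x, Real.sqrt_pos.2 hx, Real.sq_sqrt hx.le⟩
  have hl : Real.log (s ^ 2) ≤ 2 * (s - 1) := by
    rw [Real.log_pow]
    have := Real.log_le_sub_one_of_pos hs
    push_cast
    linarith
  rw [abs_le]
  -- Since x - 1 - log x ≥ (s - 1)² and x + 1 ≥ (s + 1)²/2, it remains to apply AM-GM: |s² - 1| ≤ (s
  -- + 1)²/48 + 12(s - 1)².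
  constructor <;> nlinarith [sq_nonneg ((s + 1) + 24 * (s - 1)), sq_nonneg ((s + 1) - 24 * (s - 1)),
    sq_nonneg (s - 1)]

/-! ### Averaging over winners, balanced changepoints, segments -/

/-- The sum over all functions of a function, with one value averaged out. -/
theorem sum_sum_update {α β : Type*} [Fintype α] [DecidableEq α] [Fintype β] (m : α)
    (F : (α → β) → ℝ) :
    ∑ σ : α → β, ∑ i, F (Function.update σ m i) = Fintype.card β * ∑ σ, F σ := by
  -- Exchanging the value of `σ` at `m` with the extra coordinate permutes the pairs.
  have hinv : Function.Involutive
      (fun p : (α → β) × β => (Function.update p.1 m p.2, p.1 m)) := by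
    rintro ⟨σ, i⟩
    simp
  rw [← Fintype.sum_prod_type',
    Fintype.sum_equiv hinv.toPerm (fun p : (α → β) × β => F (Function.update p.1 m p.2))
      (fun p => F p.1) (fun _ => rfl), Fintype.sum_prod_type]
  simp [Finset.mul_sum]

/-- The division of the time horizon into `M` segments of almost equal length. -/
theorem exists_balanced_changepoints (hM : 1 ≤ M) (hMT : M ≤ T) :
    ∃ ν : Fin (M + 1) → ℕ, StrictMono ν ∧ ν 0 = 1 ∧ ν (Fin.last M) = T + 1 ∧
      ∀ m : Fin M, ν m.castSucc + T / M ≤ ν m.succ ∧ ν m.succ ≤ ν m.castSucc + 2 * (T / M) := by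
  have hL : 1 ≤ T / M := (Nat.one_le_div_iff hM).2 hMT
  have hν : ∀ m : Fin M, 1 + m.castSucc.val * T / M + T / M ≤ 1 + m.succ.val * T / M ∧
      1 + m.succ.val * T / M ≤ 1 + m.castSucc.val * T / M + 2 * (T / M) := by
    intro m
    simp only [Fin.val_castSucc, Fin.val_succ, add_mul, one_mul]
    -- The floor of the sum exceeds the sum of the floors by at most 1, which is at most `T / M`.
    rw [Nat.add_div (by omega)]
    split_ifs <;> omega
  refine ⟨fun m => 1 + m.val * T / M, Fin.strictMono_iff_lt_succ.2 fun m => ?_, by simp, ?_, hν⟩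
  · have := (hν m).1
    omega
  · simp only [Fin.val_last]
    rw [Nat.mul_div_cancel_left _ (by omega)]
    omega

theorem Instance.segmentOf_eq_iff (I : Instance K M T) (t : Fin T) (m : Fin M) :
    I.segmentOf t = m ↔ (t : ℕ) + 1 ∈ I.stationarySegment m := by
  refine ⟨fun h => h ▸ I.mem_stationarySegment_segmentOf t, fun h => ?_⟩
  have h' := I.mem_stationarySegment_segmentOf t
  simp only [Instance.stationarySegment, Finset.mem_Ico] at h h'
  rcases lt_trichotomy (I.segmentOf t) m with hlt | heq | hlt
  · have := I.ν_strictMono.monotone (show (I.segmentOf t).succ ≤ m.castSucc by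
      rw [Fin.le_def]; simp; exact hlt)
    omega
  · exact heq
  · have := I.ν_strictMono.monotone (show m.succ ≤ (I.segmentOf t).castSucc by
      rw [Fin.le_def]; simp; exact hlt)
    omega

theorem Instance.card_segmentOf_eq (I : Instance K M T) (m : Fin M) :
    (Finset.univ.filter fun t => I.segmentOf t = m).card = I.ν m.succ - I.ν m.castSucc := by
  rw [← Nat.card_Ico]
  refine Finset.card_bij (fun t _ => (t : ℕ) + 1) (fun t ht => ?_) (fun s _ t _ h => ?_)
    (fun u hu => ?_)
  · exact (I.segmentOf_eq_iff t m).1 (Finset.mem_filter.1 ht).2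
  · exact Fin.ext (by omega)
  · have h1 := I.ν_strictMono.monotone (Fin.zero_le m.castSucc)
    have h2 := I.ν_strictMono.monotone (Fin.le_last m.succ)
    rw [I.ν_zero] at h1
    rw [I.ν_last] at h2
    have hu' := Finset.mem_Ico.1 hu
    refine ⟨⟨u - 1, by omega⟩, Finset.mem_filter.2 ⟨Finset.mem_univ _, ?_⟩, ?_⟩
    · rw [I.segmentOf_eq_iff]
      simp only
      rwa [Nat.sub_add_cancel (by omega)]
    · simp only
      omega

/-! ### Play counts and the comparison environments -/

/-- The number of time steps of `S` in which the arm `k` is played. -/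
def playCount {n : ℕ} (S : Finset (Fin n)) (k : Fin K) (h : History K n) : ℝ :=
  ∑ t ∈ S, playIndicator k (h t).1

theorem playCount_nonneg {n : ℕ} (S : Finset (Fin n)) (k : Fin K) (h : History K n) :
    0 ≤ playCount S k h :=
  Finset.sum_nonneg fun _ _ => playIndicator_nonneg _ _

theorem playCount_le_card {n : ℕ} (S : Finset (Fin n)) (k : Fin K) (h : History K n) :
    playCount S k h ≤ S.card := by
  simpa [playCount] using Finset.sum_le_sum (s := S) fun t _ => playIndicator_le_one k (h t).1

theorem sum_playCount_le {n : ℕ} (S : Finset (Fin n)) (h : History K n) :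
    ∑ k, playCount S k h ≤ 2 * S.card := by
  simp only [playCount]
  rw [Finset.sum_comm]
  have := Finset.sum_le_sum (s := S) fun t _ => sum_playIndicator_le_two (h t).1
  simpa [mul_comm] using this

/-- Outcome weights of the nonstationary environment in which the winner of the segment `m` is
`σ m`. -/
def winnerEnv (seg : ℕ → Fin M) (ε : ℝ) (σ : Fin M → Fin K) (t : ℕ) (r : Round K) : ℝ :=
  outcomeWeight ε (σ (seg t)) r

/-- The environment `winnerEnv` with all duels of the segment `m` replaced by fair ones. -/
def fairEnv (seg : ℕ → Fin M) (ε : ℝ) (σ : Fin M → Fin K) (m : Fin M) (t : ℕ) (r : Round K) : ℝ :=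
  if seg t = m then 1 / 2 else outcomeWeight ε (σ (seg t)) r

/-- The likelihood ratio of one round when the winner `i` is put into the segment `m` of
`fairEnv`. -/
def likelihoodFactor (seg : ℕ → Fin M) (ε : ℝ) (m : Fin M) (i : Fin K) (t : ℕ) (r : Round K) : ℝ :=
  if seg t = m then 2 * outcomeWeight ε i r else 1

section

variable (A : Algorithm K) (seg : ℕ → Fin M) {ε : ℝ} (σ : Fin M → Fin K) (m : Fin M) (i : Fin K)

/-- The fair environment ignores the value of `σ` at `m`, so it is a common reference for all
winners of that segment. The factors outside the segment are 1, so other segments contribute no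
entropy. -/
theorem winnerEnv_update :
    winnerEnv seg ε (Function.update σ m i) =
      fun t r => fairEnv seg ε σ m t r * likelihoodFactor seg ε m i t r := by
  funext t r
  by_cases h : seg t = m
  · simp [winnerEnv, fairEnv, likelihoodFactor, h]
  · simp [winnerEnv, fairEnv, likelihoodFactor, h]

theorem sum_winnerEnv (t : ℕ) (a : Fin K × Fin K) : ∑ x, winnerEnv seg ε σ t (a, x) = 1 :=
  sum_outcomeWeight _ _ _

theorem sum_fairEnv (t : ℕ) (a : Fin K × Fin K) : ∑ x, fairEnv seg ε σ m t (a, x) = 1 := by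
  by_cases h : seg t = m
  · simp [fairEnv, h]
  · simp only [fairEnv, h, if_false]
    exact sum_outcomeWeight _ _ _

variable {seg σ m i}

theorem fairEnv_nonneg (hε : 0 < ε) (hε' : ε < 1 / 2) (t : ℕ) (r : Round K) :
    0 ≤ fairEnv seg ε σ m t r := by
  unfold fairEnv
  split_ifs
  · norm_num
  · exact (outcomeWeight_pos hε hε' _ _).le

theorem likelihoodFactor_pos (hε : 0 < ε) (hε' : ε < 1 / 2) (t : ℕ) (r : Round K) :
    0 < likelihoodFactor seg ε m i t r := by
  unfold likelihoodFactor
  split_ifs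
  · linarith [outcomeWeight_pos hε hε' i r]
  · norm_num

theorem sum_fairEnv_mul_neg_log_le (hε : 0 < ε) (hε' : ε ≤ 1 / 4) (t : ℕ) (a : Fin K × Fin K) :
    ∑ x, fairEnv seg ε σ m t (a, x) * -Real.log (likelihoodFactor seg ε m i t (a, x)) ≤
      if seg t = m then 8 * ε ^ 2 * playIndicator i a else 0 := by
  by_cases h : seg t = m
  · simp only [fairEnv, likelihoodFactor, h, if_true]
    exact sum_neg_log_outcomeWeight_le hε hε' i a
  · simp [likelihoodFactor, h]

/-! ### Change of measure and regret in one segment -/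

/-- The relative entropy of the fair environment with respect to the one with winner `i` is
controlled by the number of plays of `i`. -/
theorem sum_historyWeight_neg_log_le (hε : 0 < ε) (hε' : ε ≤ 1 / 4) :
    ∑ h : History K T, historyWeight A (fairEnv seg ε σ m) T h *
        -Real.log (∏ t : Fin T, likelihoodFactor seg ε m i t (h t)) ≤
      8 * ε ^ 2 * ∑ h : History K T, historyWeight A (fairEnv seg ε σ m) T h *
        playCount (Finset.univ.filter fun t : Fin T => seg t = m) i h := by
  have hpos : ∀ (t : ℕ) r, likelihoodFactor seg ε m i t r ≠ 0 := fun t r =>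
    (likelihoodFactor_pos hε (by linarith) t r).ne'
  calc ∑ h : History K T, historyWeight A (fairEnv seg ε σ m) T h *
        -Real.log (∏ t : Fin T, likelihoodFactor seg ε m i t (h t))
      = ∑ t : Fin T, ∑ h : History K T, historyWeight A (fairEnv seg ε σ m) T h *
          -Real.log (likelihoodFactor seg ε m i t (h t)) := by
        rw [Finset.sum_comm]
        refine Finset.sum_congr rfl fun h _ => ?_
        rw [Real.log_prod (f := fun t : Fin T => likelihoodFactor seg ε m i t (h t))
          fun t _ => hpos t _, ← Finset.sum_neg_distrib, Finset.mul_sum]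
    _ ≤ ∑ t : Fin T, ∑ h : History K T, historyWeight A (fairEnv seg ε σ m) T h *
          (if seg t = m then 8 * ε ^ 2 * playIndicator i (h t).1 else 0) := by
        refine Finset.sum_le_sum fun t _ => ?_
        -- Chain rule: averaging out the outcome given the pair leaves the entropy of a single duel.
        rw [sum_historyWeight_mul_eq A (sum_fairEnv seg σ m) t fun r =>
          -Real.log (likelihoodFactor seg ε m i t r)]
        exact Finset.sum_le_sum fun h _ => mul_le_mul_of_nonneg_left
          (sum_fairEnv_mul_neg_log_le hε hε' t _)
          (historyWeight_nonneg A (fairEnv_nonneg hε (by linarith)) _ _)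
    _ = _ := by
        rw [Finset.sum_comm, Finset.mul_sum]
        refine Finset.sum_congr rfl fun h _ => ?_
        rw [← Finset.mul_sum, ← Finset.sum_filter, ← Finset.mul_sum, playCount]
        ring

/-- Putting the winner `i` into the segment `m` hardly increases the number of plays of `i`. -/
theorem sum_historyWeight_playCount_le (hε : 0 < ε) (hε' : ε ≤ 1 / 4) {S : Finset (Fin T)}
    (hS : S = Finset.univ.filter fun t : Fin T => seg t = m) :
    ∑ h : History K T, historyWeight A (winnerEnv seg ε (Function.update σ m i)) T h *
        playCount S i h ≤
      ∑ h : History K T, historyWeight A (fairEnv seg ε σ m) T h * playCount S i h +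
        S.card * (1 / 12 + 96 * ε ^ 2 *
          ∑ h : History K T, historyWeight A (fairEnv seg ε σ m) T h * playCount S i h) := by
  have hent := sum_historyWeight_neg_log_le (T := T) (i := i) A (seg := seg) (σ := σ) (m := m) hε hε'
  rw [← hS] at hent
  have hε2 : ε < 1 / 2 := by linarith
  have hp1 := sum_historyWeight A (sum_fairEnv (ε := ε) seg σ m) T
  have hq1 := sum_historyWeight A (sum_winnerEnv (ε := ε) seg (Function.update σ m i)) T
  simp only [winnerEnv_update, historyWeight_mul_prod] at hq1 ⊢
  have hp0 := historyWeight_nonneg A (fairEnv_nonneg (seg := seg) (σ := σ) (m := m) hε hε2) T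
  set p := historyWeight A (fairEnv seg ε σ m) T
  set l : History K T → ℝ := fun h => ∏ t : Fin T, likelihoodFactor seg ε m i t (h t) with hl
  have hl0 : ∀ h, 0 < l h := fun h =>
    Finset.prod_pos fun t _ => likelihoodFactor_pos hε hε2 _ _
  -- Both `p` and `p * l` have total mass 1, so on summation the 1/24 term gives 1/12, `p * l - p`
  -- cancels, and the entropy bound gives 12 · 8ε² = 96ε².
  have hpt : ∀ h, p h * l h * playCount S i h ≤ p h * playCount S i h +
      S.card * ((p h * l h + p h) / 24 + 12 * (p h * l h - p h + p h * -Real.log (l h))) := by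
    intro h
    have h1 : (l h - 1) * playCount S i h ≤
        S.card * ((l h + 1) / 24 + 12 * (l h - 1 - Real.log (l h))) :=
      calc (l h - 1) * playCount S i h ≤ |l h - 1| * playCount S i h :=
            mul_le_mul_of_nonneg_right (le_abs_self _) (playCount_nonneg _ _ _)
        _ ≤ |l h - 1| * S.card :=
            mul_le_mul_of_nonneg_left (playCount_le_card _ _ _) (abs_nonneg _)
        _ ≤ ((l h + 1) / 24 + 12 * (l h - 1 - Real.log (l h))) * S.card :=
            mul_le_mul_of_nonneg_right (abs_sub_one_le (hl0 h)) (Nat.cast_nonneg _)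
        _ = _ := mul_comm _ _
    have h2 := mul_le_mul_of_nonneg_left h1 (hp0 h)
    linear_combination h2
  have hsum := Finset.sum_le_sum fun h (_ : h ∈ Finset.univ) => hpt h
  rw [Finset.sum_add_distrib, ← Finset.mul_sum, Finset.sum_add_distrib, ← Finset.sum_div,
    ← Finset.mul_sum, Finset.sum_add_distrib, Finset.sum_add_distrib, Finset.sum_sub_distrib,
    hp1, hq1] at hsum
  refine hsum.trans (add_le_add le_rfl (mul_le_mul_of_nonneg_left ?_ (Nat.cast_nonneg _)))
  linarith

/-- The expected regret in one segment, summed over the possible winners of that segment. -/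
theorem le_sum_segmentRegret (hK : 3 ≤ K) (hε : 0 < ε) (hε' : ε ≤ 1 / 4) {S : Finset (Fin T)}
    (hS : S = Finset.univ.filter fun t : Fin T => seg t = m)
    (hεS : 5000 * ε ^ 2 * S.card ≤ K) :
    K * (ε * S.card / 6) ≤ ∑ i, ∑ h : History K T,
      historyWeight A (winnerEnv seg ε (Function.update σ m i)) T h *
        ∑ t ∈ S, ε * (1 - playIndicator (Function.update σ m i (seg t)) (h t).1) := by
  have hreg : ∀ i, ∑ h : History K T,
      historyWeight A (winnerEnv seg ε (Function.update σ m i)) T h *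
        ∑ t ∈ S, ε * (1 - playIndicator (Function.update σ m i (seg t)) (h t).1) =
      ε * (S.card - ∑ h : History K T,
        historyWeight A (winnerEnv seg ε (Function.update σ m i)) T h * playCount S i h) := by
    intro i
    have e : ∀ h : History K T,
        ∑ t ∈ S, ε * (1 - playIndicator (Function.update σ m i (seg t)) (h t).1) =
          ε * (S.card - playCount S i h) := by
      intro h
      have : ∀ t ∈ S, ε * (1 - playIndicator (Function.update σ m i (seg t)) (h t).1) =
          ε * (1 - playIndicator i (h t).1) := by
        intro t ht
        rw [hS, Finset.mem_filter] at ht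
        rw [ht.2, Function.update_self]
      rw [Finset.sum_congr rfl this, ← Finset.mul_sum, Finset.sum_sub_distrib, playCount]
      simp
    have hq1 := sum_historyWeight A (sum_winnerEnv (ε := ε) seg (Function.update σ m i)) T
    calc _ = ∑ h : History K T,
          (ε * (historyWeight A (winnerEnv seg ε (Function.update σ m i)) T h * S.card) -
          ε * (historyWeight A (winnerEnv seg ε (Function.update σ m i)) T h *
            playCount S i h)) :=
          Finset.sum_congr rfl fun h _ => by rw [e]; ring
      _ = _ := by
          rw [Finset.sum_sub_distrib, ← Finset.mul_sum, ← Finset.mul_sum, ← Finset.sum_mul, hq1]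
          ring
  simp only [hreg]
  rw [← Finset.mul_sum, Finset.sum_sub_distrib]
  have hle := Finset.sum_le_sum fun i (_ : i ∈ Finset.univ) =>
    sum_historyWeight_playCount_le (i := i) (T := T) A (seg := seg) (σ := σ) hε hε' hS
  rw [Finset.sum_add_distrib, ← Finset.mul_sum, Finset.sum_add_distrib, ← Finset.mul_sum] at hle
  have hp : ∑ i, ∑ h : History K T,
      historyWeight A (fairEnv seg ε σ m) T h * playCount S i h ≤ 2 * S.card := by
    rw [Finset.sum_comm]
    calc _ ≤ ∑ h : History K T, historyWeight A (fairEnv seg ε σ m) T h * (2 * S.card) :=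
          Finset.sum_le_sum fun h _ => by
            rw [← Finset.mul_sum]
            exact mul_le_mul_of_nonneg_left (sum_playCount_le S h)
              (historyWeight_nonneg A (fairEnv_nonneg hε (by linarith)) _ _)
      _ = 2 * S.card := by rw [← Finset.sum_mul, sum_historyWeight A (sum_fairEnv seg σ m), one_mul]
  simp only [Finset.sum_const, Finset.card_univ, Fintype.card_fin, nsmul_eq_mul] at hle ⊢
  have hK' : (3 : ℝ) ≤ K := by exact_mod_cast hK
  have hn : (0 : ℝ) ≤ S.card := Nat.cast_nonneg _
  set n : ℝ := (S.card : ℝ)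
  have h1 : 96 * ε ^ 2 * ∑ i, ∑ h : History K T,
      historyWeight A (fairEnv seg ε σ m) T h * playCount S i h ≤ 192 / 5000 * K :=
    calc _ ≤ 96 * ε ^ 2 * (2 * n) := mul_le_mul_of_nonneg_left hp (by positivity)
      _ ≤ _ := by linarith
  -- What remains is 2 ≤ K(1 - 1/12 - 192/5000 - 1/6), where the bracket exceeds 0.71; this is where
  -- K ≥ 3 enters.
  have h2 := mul_le_mul_of_nonneg_left h1 hn
  have h3 := mul_le_mul_of_nonneg_left hK' hn
  have h4 : K * (n / 6) ≤ K * n - ∑ i, ∑ h : History K T,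
      historyWeight A (winnerEnv seg ε (Function.update σ m i)) T h * playCount S i h := by
    nlinarith
  calc K * (ε * n / 6) = ε * (K * (n / 6)) := by ring
    _ ≤ _ := mul_le_mul_of_nonneg_left h4 hε.le

end

/-! ### Choice of the instance -/

/-- For every algorithm, some assignment of winners to the segments of given changepoints has a
large expected weak regret. -/
theorem exists_winners_le_expectedWeakRegret (hK : 3 ≤ K) (hM : 1 ≤ M) (A : Algorithm K)
    (I : Instance K M T) {ε : ℝ} (hε : 0 < ε) (hε' : ε ≤ 1 / 4) (hε2 : ε ≤ 1 / 2)
    (hI : ∀ m : Fin M, 5000 * ε ^ 2 * ((I.ν m.succ - I.ν m.castSucc : ℕ) : ℝ) ≤ K) :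
    ∃ σ : Fin M → Fin K, ε * T / 6 ≤
      expectedWeakRegret A { I with pref := fun m => singleWinner ε hε hε2 (σ m) } := by
  -- The default value beyond the horizon is never read by a history of length `T`.
  let seg : ℕ → Fin M := fun t => if h : t < T then I.segmentOf ⟨t, h⟩ else ⟨0, hM⟩
  have hseg : ∀ t : Fin T, seg t = I.segmentOf t := fun t => by simp [seg]
  let S : Fin M → Finset (Fin T) := fun m => Finset.univ.filter fun t : Fin T => seg t = m
  have hS : ∀ m, (S m).card = I.ν m.succ - I.ν m.castSucc := fun m => by
    rw [← I.card_segmentOf_eq]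
    simp only [S, hseg]
  let R : Fin M → (Fin M → Fin K) → ℝ := fun m σ => ∑ h : History K T,
    historyWeight A (winnerEnv seg ε σ) T h *
      ∑ t ∈ S m, ε * (1 - playIndicator (σ (seg t)) (h t).1)
  have hregret : ∀ σ : Fin M → Fin K,
      expectedWeakRegret A { I with pref := fun m => singleWinner ε hε hε2 (σ m) } =
        ∑ m, R m σ := by
    intro σ
    have hpref : ∀ t : Fin T,
        Instance.prefAt { I with pref := fun m => singleWinner ε hε hε2 (σ m) } t =
          singleWinner ε hε hε2 (σ (seg t)) := by
      intro t
      rw [hseg]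
      rfl
    rw [expectedWeakRegret, expectation_eq_sum_historyWeight A _ (winnerEnv seg ε σ)
      (fun t r => by rw [hpref, toReal_duel_singleWinner]; rfl)]
    simp only [R]
    rw [Finset.sum_comm]
    refine Finset.sum_congr rfl fun h _ => ?_
    rw [← Finset.mul_sum]
    congr 1
    simp only [S, hpref, weakRegret_singleWinner]
    exact (Finset.sum_fiberwise _ _ _).symm
  have hT : ∑ m, ((S m).card : ℝ) = T := by
    have := Finset.card_eq_sum_card_fiberwise (s := (Finset.univ : Finset (Fin T)))
      (t := (Finset.univ : Finset (Fin M))) (f := fun t : Fin T => seg t) (fun _ _ => by simp)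
    rw [Finset.card_univ, Fintype.card_fin] at this
    exact_mod_cast this.symm
  have hKpos : (0 : ℝ) < K := by exact_mod_cast (by omega : 0 < K)
  have hR : ∀ m, ∑ _σ : Fin M → Fin K, ε * (S m).card / 6 ≤ ∑ σ, R m σ := by
    intro m
    have h1 : ∑ σ : Fin M → Fin K, K * (ε * (S m).card / 6) ≤ K * ∑ σ, R m σ := by
      have h2 := sum_sum_update m (R m)
      rw [Fintype.card_fin] at h2
      rw [← h2]
      exact Finset.sum_le_sum fun σ _ => le_sum_segmentRegret A hK hε hε' rfl
        (by rw [hS]; exact hI m)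
    rw [← Finset.mul_sum] at h1
    exact le_of_mul_le_mul_left h1 hKpos
  have : Nonempty (Fin K) := ⟨⟨0, by omega⟩⟩
  obtain ⟨σ, -, hσ⟩ := Finset.exists_le_of_sum_le (s := (Finset.univ : Finset (Fin M → Fin K)))
    (f := fun _ => ε * T / 6) (g := fun σ => ∑ m, R m σ) Finset.univ_nonempty (by
      rw [Finset.sum_comm (f := fun σ m => R m σ)]
      calc _ = ∑ m, ∑ _σ : Fin M → Fin K, ε * (S m).card / 6 := by
            rw [Finset.sum_comm]
            simp only [← Finset.sum_div, ← Finset.mul_sum, hT]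
        _ ≤ _ := Finset.sum_le_sum fun m _ => hR m)
  exact ⟨σ, by rw [hregret]; exact hσ⟩

theorem exists_instance_le_expectedWeakRegret (hK : 3 ≤ K) (hM : 1 ≤ M) (hMT : M ≤ T)
    (h : M * (K - 1) ≤ 9 * T) (A : Algorithm K) :
    ∃ I : Instance K M T, 1 / 1000 * √((K : ℝ) * M * T) ≤ expectedWeakRegret A I := by
  obtain ⟨ν, hmono, h0, hlast, hν⟩ := exists_balanced_changepoints hM hMT
  have hL : 1 ≤ T / M := (Nat.one_le_div_iff hM).2 hMT
  have hTL : T ≤ 2 * (M * (T / M)) := by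
    have h1 := Nat.div_add_mod T M
    have h2 := Nat.mod_lt T hM
    nlinarith
  -- From T ≤ 2M(T/M) one gets K - 1 ≤ 18(T/M), and 1 ≤ T/M absorbs the 1.
  have hKL : K ≤ 19 * (T / M) := by
    have h1 : M * (K - 1) ≤ M * (18 * (T / M)) := by linarith
    have h2 := Nat.le_of_mul_le_mul_left h1 hM
    omega
  have hML : M * (T / M) ≤ T := Nat.mul_div_le T M
  set L := T / M
  have hL' : (1 : ℝ) ≤ L := by exact_mod_cast hL
  have hKL' : (K : ℝ) ≤ 19 * L := by exact_mod_cast hKL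
  have hML' : (M : ℝ) * L ≤ T := by exact_mod_cast hML
  have hK' : (3 : ℝ) ≤ K := by exact_mod_cast hK
  have hM' : (1 : ℝ) ≤ M := by exact_mod_cast hM
  have hKdL : (K : ℝ) / L ≤ 19 := by rwa [div_le_iff₀ (by linarith)]
  -- Segments have length at most 2L, and 5000ε² · 2L = K exactly.
  let ε : ℝ := √(K / L) / 100
  have hε : 0 < ε := div_pos (Real.sqrt_pos.2 (by positivity)) (by norm_num)
  have hsq : ε ^ 2 = K / L / 10000 := by
    simp only [ε, div_pow]
    rw [Real.sq_sqrt (by positivity)]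
    norm_num
  have hε' : ε ≤ 1 / 4 := by
    have : ε ^ 2 ≤ 19 / 10000 := by
      rw [hsq]
      linarith
    nlinarith
  let k : Fin K := ⟨0, by omega⟩
  have hε2 : ε ≤ 1 / 2 := by linarith
  obtain ⟨σ, hσ⟩ := exists_winners_le_expectedWeakRegret hK hM A
    { ν := ν, ν_strictMono := hmono, ν_zero := h0, ν_last := hlast,
      pref := fun _ => singleWinner ε hε hε2 k } hε hε' hε2 (fun m => by
      have h1 : ((ν m.succ - ν m.castSucc : ℕ) : ℝ) ≤ 2 * L := by
        have := (hν m).2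
        exact_mod_cast (by omega : ν m.succ - ν m.castSucc ≤ 2 * L)
      calc 5000 * ε ^ 2 * ((ν m.succ - ν m.castSucc : ℕ) : ℝ) ≤ 5000 * ε ^ 2 * (2 * L) :=
            mul_le_mul_of_nonneg_left h1 (by positivity)
        _ = K := by
            rw [hsq]
            field_simp
            norm_num)
  refine ⟨_, le_trans ?_ hσ⟩
  have h1 : √((K : ℝ) * M * T) ≤ √(K / L) * T := by
    rw [← Real.sqrt_sq (Nat.cast_nonneg T : (0 : ℝ) ≤ T), ← Real.sqrt_mul (by positivity),
      Real.sqrt_sq (Nat.cast_nonneg T)]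
    refine Real.sqrt_le_sqrt ?_
    rw [div_mul_eq_mul_div, le_div_iff₀ (by linarith)]
    have h2 : (K : ℝ) * T * (M * L) ≤ K * T * T := mul_le_mul_of_nonneg_left hML' (by positivity)
    linarith
  have h3 : ε * T / 6 = 1 / 600 * (√(K / L) * T) := by
    simp only [ε]
    ring
  rw [h3]
  have h4 := Real.sqrt_nonneg ((K : ℝ) * M * T)
  linarith

end DuelingBandits

end

theorem theorem5 :
    (∃ c : ℝ, 0 < c ∧ ∀ K M T : ℕ, 3 ≤ K → 1 ≤ M → M ≤ T → M * (K - 1) ≤ 9 * T →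
      ∀ A : DuelingBandits.Algorithm K, ∃ I : DuelingBandits.Instance K M T,
        c * Real.sqrt ((K : ℝ) * M * T) ≤ DuelingBandits.expectedWeakRegret A I ∧
        c * Real.sqrt ((K : ℝ) * M * T) ≤ DuelingBandits.expectedBinaryWeakRegret A I) ∧
    (∃ c : ℝ, 0 < c ∧ ∀ K T : ℕ, 3 ≤ K → 1 ≤ T → K - 1 ≤ 9 * T →
      ∀ A : DuelingBandits.Algorithm K, ∃ I : DuelingBandits.StationaryInstance K T,
        c * Real.sqrt ((K : ℝ) * T) ≤ DuelingBandits.expectedWeakRegret A I ∧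
        c * Real.sqrt ((K : ℝ) * T) ≤ DuelingBandits.expectedBinaryWeakRegret A I) := by
  refine ⟨⟨1 / 1000, by norm_num, fun K M T hK hM hMT h A => ?_⟩,
    ⟨1 / 1000, by norm_num, fun K T hK hT h A => ?_⟩⟩
  · obtain ⟨I, hI⟩ := DuelingBandits.exists_instance_le_expectedWeakRegret hK hM hMT h A
    exact ⟨I, hI, hI.trans (DuelingBandits.expectedWeakRegret_le_expectedBinaryWeakRegret A I)⟩
  · obtain ⟨I, hI⟩ := DuelingBandits.exists_instance_le_expectedWeakRegret hK le_rfl hT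
      (by rwa [one_mul]) A
    rw [Nat.cast_one, mul_one] at hI
    exact ⟨I, hI, hI.trans (DuelingBandits.expectedWeakRegret_le_expectedBinaryWeakRegret A I)⟩
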